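/- Let $a=(a_\ell)_{\ell\in\mathbb Z}$ be a finitely supported complex sequence with $\sum_{\ell\in\mathbb Z} a_\ell=1$, and let $\widehat F_a(\theta):=\sum_{\ell\in\mathbb Z}a_\ell\,e^{i\ell\theta}$, $\theta\in\mathbb C$, be its Fourier transform. Assume that $|\widehat F_a(\theta)|<1$ for every $\theta\in[-\pi,\pi]\setminus\{0\}$, and that there exist $\alpha\in\mathbb R$, $c_3\in\mathbb R\setminus\{0\}$, $c_4>0$ and a function $\varphi$ holomorphic on a neighborhood of $0$ in $\mathbb C$ such that, for all complex $\theta$ in a neighborhood of $0$, $$\widehat F_a(\theta)=\exp\bigl(i\alpha\theta-i c_3\theta^3-c_4\theta^4+\theta^5\varphi(\theta)\bigr).$$ Let $L_a$ be the Laurent (convolution) operator $(L_a u)_j:=\sum_{\ell\in\mathbb Z}a_\ell\,u_{j-\ell}$, $j\in\mathbb Z$, acting on complex sequences indexed by $\mathbb Z$. Then there exists a constant $C>0$, depending only on $a$, such that for every complex sequence $u=(u_j)_{j\in\mathbb Z}$ of bounded variation (that is, $\sum_{j\in\mathbb Z}|u_{j+1}-u_j|<\infty$) with $\lim_{j\to-\infty}u_j=0$,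 $$\sup_{n\in\mathbb N}\ \sup_{j\in\mathbb Z}\ \bigl|(L_a^{\,n}u)_j\bigr|\ \le\ C\sum_{j\in\mathbb Z}|u_{j+1}-u_j|.$$ -/

import Mathlib

open scoped ENNReal NNReal Topology

noncomputable section

namespace LaurentBV

/-- The Laurent (convolution) operator `L_a u = a ⋆ u`, `(L_a u)_j = ∑_ℓ a_ℓ u_{j-ℓ}`.
It is only used below for finitely supported `a`, for which every series is a finite sum. -/
def laurentOp (a : ℤ → ℂ) (u : ℤ → ℂ) : ℤ → ℂ :=
  fun j => ∑' ℓ : ℤ, a ℓ * u (j - ℓ)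

/-- The Fourier transform `F_a(θ) = ∑_ℓ a_ℓ e^{iℓθ}` of a finitely supported sequence, at a
complex argument `θ` (for finitely supported `a` it is an entire function). -/
def fourierSymbol (a : ℤ → ℂ) (θ : ℂ) : ℂ :=
  ∑' ℓ : ℤ, a ℓ * Complex.exp (Complex.I * (ℓ : ℂ) * θ)

/-- The standing assumption on the sequence `a`: finite support, total mass one, dissipation away
from the frequency `0`, and a dispersive expansion at the frequency `0`. -/
structure DispersiveAssumption (a : ℤ → ℂ) : Prop where
  finite_support : (Function.support a).Finite
  sum_eq_one : ∑' ℓ : ℤ, a ℓ = 1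
  dissipation : ∀ θ : ℝ, θ ∈ Set.Icc (-Real.pi) Real.pi \ {0} → ‖fourierSymbol a (θ : ℂ)‖ < 1
  expansion : ∃ α c₃ c₄ : ℝ, c₃ ≠ 0 ∧ 0 < c₄ ∧ ∃ φ : ℂ → ℂ, AnalyticAt ℂ φ 0 ∧
    ∀ᶠ θ : ℂ in 𝓝 0, fourierSymbol a θ =
      Complex.exp (Complex.I * (α : ℂ) * θ - Complex.I * (c₃ : ℂ) * θ ^ 3
        - (c₄ : ℂ) * θ ^ 4 + θ ^ 5 * φ θ)

/-- The total variation `∑_j |u_{j+1} - u_j| ∈ [0, ∞]` of a sequence. -/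
def totalVariation (u : ℤ → ℂ) : ℝ≥0∞ :=
  ∑' j : ℤ, ‖u (j + 1) - u j‖ₑ

/-- `u ∈ BV(ℤ; ℂ)`: the total variation is finite. -/
def BV (u : ℤ → ℂ) : Prop :=
  totalVariation u < ∞

/-- The `ℓ^∞` norm `sup_j |v_j| ∈ [0, ∞]` (equal to `∞` exactly for unbounded sequences). -/
def supNorm (v : ℤ → ℂ) : ℝ≥0∞ :=
  ⨆ j : ℤ, ‖v j‖ₑ

end LaurentBV

end

/-! A sequence of bounded variation vanishing at `-∞` is the superposition of translated unit steps
weighted by its jumps. Since `L_a^n` is linear and commutes with translations, it suffices to bound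
`L_a^n` on a single step, uniformly in `n` and in the position `m`.

The value at `m` is a partial sum of the Fourier coefficients of `F_a^n`. Writing the step as `1/2 +
sign/2`, with the sign at a half-integer given by a Dirichlet integral, turns it into `1/2` plus
`1/(2π)` times the integral over `(0, π)` of the odd part of `e^{-ixθ} F_a(θ)^n` divided by
`sin(θ/2)`, where `x = m - 1/2` (`sum_ite_eq_integral_modulatedOddPart`).

Taking the odd part tames the singularity at `0`. The range is cut at `A`, of order `n^{-1/4}`, and
at a fixed `δ`. Beyond `δ` the integrand is bounded. On `[A, δ]` the damping `e^{-ncθ⁴}` beats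
`1/θ`. On `[0, A]` the damping is negligible, and what remains is the integral of `sin((nα - x)θ - n
c₃ θ³)/θ`, which is bounded whatever the coefficients of the cubic phase: a Stein–Wainger estimate
(`abs_integral_sin_linear_sub_cubic_le`). -/

/-! ### Oscillatory integrals with a cubic phase and amplitude `1 / t` -/

/-- First derivative test for the phase `p` with the amplitude `1 / t` on `[1, ∞)`. -/
theorem abs_integral_sin_div_le_of_one_le_abs_deriv {p q q' : ℝ → ℝ} {a b : ℝ} (ha : 1 ≤ a)
    (hab : a ≤ b) (hp : ∀ t, HasDerivAt p (q t) t) (hq : ∀ t, HasDerivAt q (q' t) t)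
    (hq' : ∀ t ∈ Set.Icc a b, q' t ≤ 0) (h1 : ∀ t ∈ Set.Icc a b, 1 ≤ |q t|) :
    |∫ t in a..b, Real.sin (p t) / t| ≤ 5 := by
  have hpos : ∀ t ∈ Set.Icc a b, 0 < t := fun t ht => by linarith [ht.1]
  have hq0 : ∀ t ∈ Set.Icc a b, q t ≠ 0 := fun t ht h => by
    have := h1 t ht
    rw [h] at this; norm_num at this
  have hpc : Continuous p := continuous_iff_continuousAt.2 fun t => (hp t).continuousAt
  have hcont : ContinuousOn (fun t => Real.sin (p t) / t) (Set.Icc a b) := by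
    apply ContinuousOn.div (by fun_prop) (by fun_prop)
    intro t ht; exact (hpos t ht).ne'
  set I : ℝ → ℝ := fun T => ∫ t in a..T, Real.sin (p t) / t with hI
  have hgd : ∀ t ∈ Set.Icc a b, HasDerivAt (fun s => Real.cos (p s) * (s * q s)⁻¹)
      (-Real.sin (p t) * q t * (t * q t)⁻¹
        + Real.cos (p t) * (-(1 * q t + t * q' t) / (t * q t) ^ 2)) t := by
    intro t ht
    have h2 := ((hasDerivAt_id t).mul (hq t)).inv
      (mul_ne_zero (hpos t ht).ne' (hq0 t ht))
    exact (hp t).cos.mul h2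
  have hId : ∀ t ∈ Set.Ico a b, HasDerivWithinAt I (Real.sin (p t) / t) (Set.Ici t) t := by
    intro t ht
    have ht' : t ∈ Set.Icc a b := ⟨ht.1, ht.2.le⟩
    have hca : ContinuousAt (fun t => Real.sin (p t) / t) t :=
      ContinuousAt.div (by fun_prop) continuousAt_id (hpos t ht').ne'
    refine (intervalIntegral.integral_hasDerivAt_right ?_ ?_ hca).hasDerivWithinAt
    · apply ContinuousOn.intervalIntegrable
      rw [Set.uIcc_of_le ht.1]
      exact hcont.mono (Set.Icc_subset_Icc le_rfl ht.2.le)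
    · refine ⟨Set.univ, Filter.univ_mem, ?_⟩
      rw [MeasureTheory.Measure.restrict_univ]
      exact ((hpc.measurable.sin).div measurable_id).aestronglyMeasurable
  have hIc : ContinuousOn I (Set.Icc a b) := by
    have := intervalIntegral.continuousOn_primitive_interval
      (μ := MeasureTheory.volume) (f := fun t => Real.sin (p t) / t) (a := a) (b := b)
      (by rw [Set.uIcc_of_le hab]; exact hcont.integrableOn_Icc)
    rwa [Set.uIcc_of_le hab] at this
  -- Integration by parts: `g` is minus the boundary term, so `I + g` has derivative `cos p · (1 /
  -- (t q))'`, free of the non-decaying oscillation.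
  set g : ℝ → ℝ := fun s => Real.cos (p s) * (s * q s)⁻¹ with hg
  have hgb : ∀ t ∈ Set.Icc a b, |g t| ≤ 1 := by
    intro t ht
    rw [hg]
    simp only [abs_mul, abs_inv]
    have h3 : 1 ≤ |t| * |q t| := by
      have : 1 ≤ |t| := by rw [abs_of_pos (hpos t ht)]; linarith [ht.1]
      nlinarith [h1 t ht]
    calc |Real.cos (p t)| * (|t| * |q t|)⁻¹ ≤ 1 * 1 := by
          apply mul_le_mul (Real.abs_cos_le_one _) (inv_le_one_of_one_le₀ h3) (by positivity)
            zero_le_one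
      _ = 1 := one_mul 1
  -- `B` starts at `1 ≥ |g a|` and adds primitives of `1 / t²` and `-q' / q²`, which dominate the
  -- derivative of `I + g`. Comparison with `B` requires no integrability of `q'`. At `b` it is at
  -- most `4`; removing `g b` costs one more, hence `5`.
  set B : ℝ → ℝ := fun t => 1 + (a⁻¹ - t⁻¹) + ((q t)⁻¹ - (q a)⁻¹) with hB
  have hBd : ∀ t ∈ Set.Icc a b, HasDerivAt B ((t ^ 2)⁻¹ + -q' t / q t ^ 2) t := by
    intro t ht
    have h2 := (((hasDerivAt_inv (hpos t ht).ne').const_sub (a⁻¹)).const_add 1).add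
      (((hq t).fun_inv (hq0 t ht)).sub_const (q a)⁻¹)
    refine (h2.congr_deriv ?_).congr_of_eventuallyEq (Filter.Eventually.of_forall fun s => ?_)
    · simp [neg_div]
    · simp only [hB, Pi.add_apply]
  have ha' : a ∈ Set.Icc a b := ⟨le_rfl, hab⟩
  have hb' : b ∈ Set.Icc a b := ⟨hab, le_rfl⟩
  have key := image_norm_le_of_norm_deriv_right_le_deriv_boundary'
    (f := fun t => I t + g t)
    (f' := fun t => Real.cos (p t) * (-(1 * q t + t * q' t) / (t * q t) ^ 2))
    (a := a) (b := b) (B := B) (B' := fun t => (t ^ 2)⁻¹ + -q' t / q t ^ 2)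
    (hIc.add fun t ht => (hgd t ht).continuousAt.continuousWithinAt)
    (fun t ht => by
      have ht' : t ∈ Set.Icc a b := ⟨ht.1, ht.2.le⟩
      refine ((hId t ht).add (hgd t ht').hasDerivWithinAt).congr_deriv ?_
      have h4 := hq0 t ht'
      have h5 := (hpos t ht').ne'
      field_simp
      ring)
    (by
      have : I a = 0 := by simp [hI]
      rw [this, zero_add, Real.norm_eq_abs, hB]
      have := hgb a ha'
      simp only [sub_self, add_zero]; linarith)
    (fun t ht => (hBd t ht).continuousAt.continuousWithinAt)
    (fun t ht => (hBd t ⟨ht.1, ht.2.le⟩).hasDerivWithinAt)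
    (fun t ht => by
      have ht' : t ∈ Set.Icc a b := ⟨ht.1, ht.2.le⟩
      have h4 := hq0 t ht'
      have h5 := hpos t ht'
      have h6 : 1 ≤ t := ha.trans ht.1
      rw [Real.norm_eq_abs, abs_mul]
      have e : -(1 * q t + t * q' t) / (t * q t) ^ 2
          = -(1 / (t ^ 2 * q t)) + (-q' t) / (t * q t ^ 2) := by
        field_simp
        ring
      rw [e]
      have b1 : |-(1 / (t ^ 2 * q t))| ≤ (t ^ 2)⁻¹ := by
        rw [abs_neg, abs_div, abs_one, abs_mul, abs_of_pos (by positivity : 0 < t ^ 2),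
          one_div, mul_inv]
        exact mul_le_of_le_one_right (by positivity) (inv_le_one_of_one_le₀ (h1 t ht'))
      have hq'' : 0 ≤ -q' t := by linarith [hq' t ht']
      have b2 : |(-q' t) / (t * q t ^ 2)| ≤ -q' t / q t ^ 2 := by
        rw [abs_of_nonneg (by positivity)]
        have : 0 < q t ^ 2 := by positivity
        gcongr
        nlinarith
      calc |Real.cos (p t)| * |-(1 / (t ^ 2 * q t)) + (-q' t) / (t * q t ^ 2)|
          ≤ 1 * |-(1 / (t ^ 2 * q t)) + (-q' t) / (t * q t ^ 2)| := by
            gcongr; exact Real.abs_cos_le_one _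
        _ ≤ _ := by rw [one_mul]; exact (abs_add_le _ _).trans (add_le_add b1 b2))
    hb'
  have hBb : B b ≤ 4 := by
    rw [hB]
    have c1 : a⁻¹ ≤ 1 := inv_le_one_of_one_le₀ ha
    have c2 : 0 ≤ b⁻¹ := inv_nonneg.2 (hpos b hb').le
    have c3 : ∀ t ∈ Set.Icc a b, |(q t)⁻¹| ≤ 1 := fun t ht => by
      rw [abs_inv]; exact inv_le_one_of_one_le₀ (h1 t ht)
    have c4 := (abs_le.1 (c3 a ha')).1
    have c5 := (abs_le.1 (c3 b hb')).2
    simp only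
    linarith
  have hgb' := abs_le.1 (hgb b hb')
  have key' := abs_le.1 (key.trans hBb)
  exact abs_le.2 ⟨by linarith [key'.1, hgb'.2], by linarith [key'.2, hgb'.1]⟩

/-- Off `t = 0` the integrand is the continuous function `r t * sinc (t * r t)`. -/
theorem intervalIntegrable_sin_mul_div {r : ℝ → ℝ} (hr : Continuous r) (a b : ℝ) :
    IntervalIntegrable (fun t => Real.sin (t * r t) / t) MeasureTheory.volume a b := by
  have h : IntervalIntegrable (fun t => r t * Real.sinc (t * r t)) MeasureTheory.volume a b :=
    (hr.mul (Real.continuous_sinc.comp (continuous_id.mul hr))).intervalIntegrable a b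
  refine h.congr_ae ?_
  refine MeasureTheory.ae_restrict_of_ae ?_
  filter_upwards [MeasureTheory.Measure.ae_ne MeasureTheory.volume (0 : ℝ)] with t ht
  by_cases h0 : r t = 0
  · simp [h0]
  · rw [Real.sinc_of_ne_zero (mul_ne_zero ht h0)]
    field_simp

theorem abs_integral_sin_div_le_of_phase_le {r : ℝ → ℝ} {X M : ℝ}
    (hX : 0 ≤ X) (h : ∀ t ∈ Set.Ioc 0 X, |r t| ≤ M) :
    |∫ t in (0 : ℝ)..X, Real.sin (t * r t) / t| ≤ M * X := by
  have := intervalIntegral.norm_integral_le_of_norm_le_const (a := 0) (b := X) (C := M)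
    (f := fun t => Real.sin (t * r t) / t) (fun t ht => by
      rw [Set.uIoc_of_le hX] at ht
      have h1 : |Real.sin (t * r t)| ≤ |t * r t| := Real.abs_sin_le_abs
      rw [Real.norm_eq_abs, abs_div, div_le_iff₀ (abs_pos.2 ht.1.ne')]
      rw [abs_mul] at h1
      nlinarith [h t ht, abs_nonneg t])
  rwa [sub_zero, abs_of_nonneg hX] at this

theorem abs_integral_sin_div_self_le {X : ℝ} (hX : 0 ≤ X) :
    |∫ t in (0 : ℝ)..X, Real.sin t / t| ≤ 6 := by
  have hint := fun a b => intervalIntegrable_sin_mul_div (r := fun _ => 1) continuous_const a b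
  have hsmall := fun {Y : ℝ} (hY : 0 ≤ Y) =>
    abs_integral_sin_div_le_of_phase_le (r := fun _ => 1) (M := 1) hY (by simp)
  simp only [mul_one] at hint hsmall
  rcases le_total X 1 with h | h
  · linarith [hsmall hX]
  · rw [← intervalIntegral.integral_add_adjacent_intervals (hint 0 1) (hint 1 X)]
    refine (abs_add_le _ _).trans ?_
    have h2 := abs_integral_sin_div_le_of_one_le_abs_deriv (p := fun t => t) (q := fun _ => 1)
      (q' := fun _ => 0) le_rfl h hasDerivAt_id' (fun t => hasDerivAt_const t 1) (by simp)
      (by simp)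
    linarith [hsmall zero_le_one]

/-- The measure `dt / t` is invariant under dilation. This is what makes the bounds below
independent of the coefficients of the phase. -/
theorem integral_comp_mul_div (f : ℝ → ℝ) {s : ℝ} (hs : 0 < s) (X : ℝ) :
    ∫ t in (0 : ℝ)..X, f (s * t) / t = ∫ t in (0 : ℝ)..s * X, f t / t := by
  have := intervalIntegral.smul_integral_comp_mul_left (a := 0) (b := X)
    (fun t => f t / t) s
  rw [mul_zero] at this
  rw [← this, smul_eq_mul, ← intervalIntegral.integral_const_mul]
  congr 1
  ext t
  rcases eq_or_ne t 0 with rfl | ht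
  · simp
  · field_simp

theorem abs_integral_sin_mul_div_le (x : ℝ) {X : ℝ} (hX : 0 ≤ X) :
    |∫ t in (0 : ℝ)..X, Real.sin (x * t) / t| ≤ 6 := by
  rcases lt_trichotomy x 0 with h | rfl | h
  · have e : ∀ t : ℝ, Real.sin (x * t) / t = -(Real.sin (-x * t) / t) := fun t => by
      rw [neg_mul, Real.sin_neg]; ring
    simp only [e, intervalIntegral.integral_neg, abs_neg]
    rw [integral_comp_mul_div Real.sin (by linarith : 0 < -x)]
    exact abs_integral_sin_div_self_le (mul_nonneg (by linarith) hX)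
  · simp
  · rw [integral_comp_mul_div Real.sin h]
    exact abs_integral_sin_div_self_le (mul_nonneg h.le hX)

/-- On `[0, 1]` dropping the cubic term changes the integrand by at most `t² ≤ 1`, which adds `1` to
the bound `6` for the linear phase. -/
theorem abs_integral_sin_linear_sub_cube_le_of_le_one (x : ℝ) {X : ℝ} (hX : 0 ≤ X) (h1 : X ≤ 1) :
    |∫ t in (0 : ℝ)..X, Real.sin (x * t - t ^ 3) / t| ≤ 7 := by
  have i1 := intervalIntegrable_sin_mul_div (r := fun t => x - t ^ 2) (by fun_prop) 0 X
  have i2 := intervalIntegrable_sin_mul_div (r := fun _ => x) (by fun_prop) 0 X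
  have e1 : ∀ t : ℝ, t * (x - t ^ 2) = x * t - t ^ 3 := fun t => by ring
  simp only [e1, mul_comm _ x] at i1 i2
  have hd := intervalIntegral.norm_integral_le_of_norm_le_const (a := 0) (b := X) (C := 1)
    (f := fun t => Real.sin (x * t - t ^ 3) / t - Real.sin (x * t) / t) (fun t ht => by
      rw [Set.uIoc_of_le hX] at ht
      have h3 : |Real.sin (x * t - t ^ 3) - Real.sin (x * t)| ≤ t ^ 3 := by
        have := Real.abs_sin_sub_sin_le (x * t - t ^ 3) (x * t)
        rwa [sub_sub_cancel_left, abs_neg, abs_of_pos (pow_pos ht.1 3)] at this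
      rw [← sub_div, Real.norm_eq_abs, abs_div, abs_of_pos ht.1, div_le_iff₀ ht.1, one_mul]
      refine h3.trans ?_
      exact pow_le_of_le_one ht.1.le (ht.2.trans h1) (by norm_num))
  rw [intervalIntegral.integral_sub i1 i2, sub_zero, abs_of_nonneg hX, Real.norm_eq_abs] at hd
  have h6 := abs_le.1 (abs_integral_sin_mul_div_le x hX)
  have hd' := abs_le.1 hd
  exact abs_le.2 ⟨by linarith [hd'.1, h6.1], by linarith [hd'.2, h6.2]⟩

/-- The derivative `x - 3t²` of the phase is smaller than `1` in absolute value only on an interval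
of length at most `1`, where the trivial bound suffices. The first derivative test handles both
sides of it. With `[0, 1]` apart, the total is `7 + 5 + 1 + 5 = 18`. -/
theorem abs_integral_sin_linear_sub_cube_le (x : ℝ) {X : ℝ} (hX : 0 ≤ X) :
    |∫ t in (0 : ℝ)..X, Real.sin (x * t - t ^ 3) / t| ≤ 18 := by
  have hint := fun a b => intervalIntegrable_sin_mul_div (r := fun t => x - t ^ 2)
    (by fun_prop) a b
  have e1 : ∀ t : ℝ, t * (x - t ^ 2) = x * t - t ^ 3 := fun t => by ring
  simp only [e1] at hint
  rcases le_total X 1 with h | h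
  · linarith [abs_integral_sin_linear_sub_cube_le_of_le_one x hX h]
  have hgood : ∀ a b : ℝ, 1 ≤ a → a ≤ b → (∀ t ∈ Set.Icc a b, 1 ≤ |x - 3 * t ^ 2|) →
      |∫ t in a..b, Real.sin (x * t - t ^ 3) / t| ≤ 5 := fun a b ha hab hq =>
    abs_integral_sin_div_le_of_one_le_abs_deriv (q := fun t => x - 3 * t ^ 2)
      (q' := fun t => -(6 * t)) ha hab
      (fun t => by
        refine (((hasDerivAt_id' t).const_mul x).sub (hasDerivAt_pow 3 t)).congr_deriv ?_
        norm_num)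
      (fun t => by
        refine (((hasDerivAt_pow 2 t).const_mul 3).const_sub x).congr_deriv ?_
        norm_num; ring)
      (fun t ht => by linarith [ht.1]) hq
  -- For `t ≥ 1`, `t ≤ u` means `x - 3t² ≥ 1` and `t ≥ v` means `x - 3t² ≤ -1`; a negative radicand
  -- gives the root `0`, which is harmless here. Below, `m` and `k` are `u` and `v` clamped to `[1,
  -- X]`.
  set u := Real.sqrt ((x - 1) / 3) with hu
  set v := Real.sqrt ((x + 1) / 3) with hv
  have huv : u ≤ v := Real.sqrt_le_sqrt (by linarith)
  have hvu : v ≤ u + 1 := by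
    rw [hv, Real.sqrt_le_left (by positivity)]
    have : (x - 1) / 3 ≤ u ^ 2 := by
      rcases le_total 0 ((x - 1) / 3) with h0 | h0
      · rw [hu, Real.sq_sqrt h0]
      · exact h0.trans (sq_nonneg _)
    nlinarith [Real.sqrt_nonneg ((x - 1) / 3)]
  set m := max 1 (min X u) with hm
  set k := max 1 (min X v) with hk
  have hmk : m ≤ k := by
    apply max_le_max le_rfl (min_le_min le_rfl huv)
  have hkm : k ≤ m + 1 := by
    apply max_le
    · linarith [le_max_left 1 (min X u)]
    · have h2 : min X v ≤ min X u + 1 := by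
        rcases le_total X u with h3 | h3
        · rw [min_eq_left h3]; linarith [min_le_left X v]
        · rw [min_eq_right h3]; linarith [min_le_right X v]
      linarith [le_max_right 1 (min X u)]
  have hm1 : 1 ≤ m := le_max_left _ _
  have hkX : k ≤ X := max_le h (min_le_left _ _)
  have p1 : |∫ t in (1 : ℝ)..m, Real.sin (x * t - t ^ 3) / t| ≤ 5 := by
    rcases le_total (min X u) 1 with h2 | h2
    · rw [hm, max_eq_left h2]; simp
    · refine hgood 1 m le_rfl hm1 fun t ht => ?_
      have htu : t ≤ u := by
        rw [hm, max_eq_right h2] at ht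
        exact ht.2.trans (min_le_right _ _)
      have ht2 := (Real.le_sqrt' (by linarith [ht.1])).1 htu
      rw [le_abs]; left; linarith
  have p2 : |∫ t in m..k, Real.sin (x * t - t ^ 3) / t| ≤ 1 := by
    have := intervalIntegral.norm_integral_le_of_norm_le_const (a := m) (b := k) (C := 1)
      (f := fun t => Real.sin (x * t - t ^ 3) / t) (fun t ht => by
        rw [Set.uIoc_of_le hmk] at ht
        have : 1 ≤ |t| := (by linarith [ht.1] : 1 ≤ t).trans (le_abs_self t)
        rw [Real.norm_eq_abs, abs_div]
        exact div_le_one_of_le₀ ((Real.abs_sin_le_one _).trans this) (abs_nonneg t))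
    rw [one_mul, abs_of_nonneg (by linarith)] at this
    exact this.trans (by linarith)
  have p3 : |∫ t in k..X, Real.sin (x * t - t ^ 3) / t| ≤ 5 := by
    rcases le_total X v with h2 | h2
    · rw [hk, min_eq_left h2, max_eq_right h]; simp
    · refine hgood k X (hm1.trans hmk) hkX fun t ht => ?_
      have hvt : v ≤ t := by
        rw [hk, min_eq_right h2] at ht
        exact (le_max_right _ _).trans ht.1
      have ht2 := (Real.sqrt_le_left (by linarith [ht.1])).1 hvt
      rw [le_abs]; right; linarith
  rw [← intervalIntegral.integral_add_adjacent_intervals (hint 0 1) (hint 1 X),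
    ← intervalIntegral.integral_add_adjacent_intervals (hint 1 m) (hint m X),
    ← intervalIntegral.integral_add_adjacent_intervals (hint m k) (hint k X)]
  have p0 := abs_le.1 (abs_integral_sin_linear_sub_cube_le_of_le_one x zero_le_one le_rfl)
  have p1' := abs_le.1 p1
  have p2' := abs_le.1 p2
  have p3' := abs_le.1 p3
  exact abs_le.2 ⟨by linarith [p0.1, p1'.1, p2'.1, p3'.1], by linarith [p0.2, p1'.2, p2'.2, p3'.2]⟩

theorem abs_integral_sin_linear_sub_cubic_le_of_pos (x : ℝ) {y : ℝ} (hy : 0 < y) {X : ℝ}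
    (hX : 0 ≤ X) : |∫ t in (0 : ℝ)..X, Real.sin (x * t - y * t ^ 3) / t| ≤ 18 := by
  obtain ⟨s, hs, hsy⟩ : ∃ s : ℝ, 0 < s ∧ s ^ 3 = y :=
    ⟨y ^ (1 / 3 : ℝ), by positivity, by
      rw [← Real.rpow_natCast, ← Real.rpow_mul hy.le]; norm_num⟩
  have := integral_comp_mul_div (fun t => Real.sin (x / s * t - t ^ 3)) hs X
  have e : ∀ t : ℝ, x / s * (s * t) - (s * t) ^ 3 = x * t - y * t ^ 3 := fun t => by
    rw [← hsy]; field_simp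
  simp only [e] at this
  rw [this]
  exact abs_integral_sin_linear_sub_cube_le _ (by positivity)

/-- The cubic case of the Stein–Wainger estimate: the bound is uniform in the phase. -/
theorem abs_integral_sin_linear_sub_cubic_le (x y : ℝ) {X : ℝ} (hX : 0 ≤ X) :
    |∫ t in (0 : ℝ)..X, Real.sin (x * t - y * t ^ 3) / t| ≤ 18 := by
  rcases lt_trichotomy y 0 with h | rfl | h
  · have e : ∀ t : ℝ, Real.sin (x * t - y * t ^ 3) / t
        = -(Real.sin (-x * t - -y * t ^ 3) / t) := fun t => by
      rw [← neg_div, ← Real.sin_neg]; congr 2; ring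
    simp only [e, intervalIntegral.integral_neg, abs_neg]
    exact abs_integral_sin_linear_sub_cubic_le_of_pos (-x) (by linarith) hX
  · simp only [zero_mul, sub_zero]
    linarith [abs_integral_sin_mul_div_le x hX]
  · exact abs_integral_sin_linear_sub_cubic_le_of_pos x h hX

/-! ### Uniform bound for the singular integral -/

open Complex in
/-- The odd part `(G(-θ) - G(θ)) / 2i` of `G(θ) = e^{-ixθ} F(θ)^n`. -/
noncomputable def modulatedOddPart (F : ℝ → ℂ) (n : ℕ) (x θ : ℝ) : ℂ :=
  (exp (-(I * (x * (-θ) : ℝ))) * F (-θ) ^ n - exp (-(I * (x * θ : ℝ))) * F θ ^ n) / (2 * I)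

theorem norm_modulatedOddPart_le {F : ℝ → ℂ} {n : ℕ} {x θ r : ℝ} (h1 : ‖F θ‖ ^ n ≤ r)
    (h2 : ‖F (-θ)‖ ^ n ≤ r) : ‖modulatedOddPart F n x θ‖ ≤ r := by
  have e : ∀ y : ℝ, ‖Complex.exp (-(Complex.I * (y : ℝ)))‖ = 1 := fun y => by
    rw [← mul_neg, ← Complex.ofReal_neg, mul_comm]; exact Complex.norm_exp_ofReal_mul_I _
  rw [modulatedOddPart, norm_div, norm_mul, Complex.norm_I, Complex.norm_two, mul_one,
    div_le_iff₀ two_pos]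
  refine (norm_sub_le _ _).trans ?_
  rw [norm_mul, norm_mul, e, e, one_mul, one_mul, norm_pow, norm_pow]
  linarith

/-- Jordan's inequality `sin y ≥ 2y/π` at `y = θ / 2`. -/
theorem one_div_sin_half_le {θ : ℝ} (h0 : 0 < θ) (h1 : θ ≤ Real.pi) :
    0 < Real.sin (θ / 2) ∧ (Real.sin (θ / 2))⁻¹ ≤ Real.pi / θ := by
  have h := Real.mul_le_sin (x := θ / 2) (by linarith) (by linarith)
  have e : 2 / Real.pi * (θ / 2) = θ / Real.pi := by ring
  rw [e] at h
  have hp : 0 < θ / Real.pi := div_pos h0 Real.pi_pos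
  refine ⟨hp.trans_le h, ?_⟩
  exact (inv_anti₀ hp h).trans_eq (inv_div _ _)

theorem abs_inv_sin_half_sub_le {θ : ℝ} (h0 : 0 < θ) (h1 : θ ≤ 1) :
    |(Real.sin (θ / 2))⁻¹ - 2 / θ| ≤ 1 := by
  obtain ⟨hs, hs'⟩ := one_div_sin_half_le h0 (by linarith [Real.pi_gt_three])
  have h3 := Real.sin_gt_sub_cube (x := θ / 2) (by linarith)
  have h4 := Real.sin_lt (x := θ / 2) (by linarith)
  have h5 : (Real.sin (θ / 2))⁻¹ - 2 / θ
      = (θ / 2 - Real.sin (θ / 2)) * (2 / θ) * (Real.sin (θ / 2))⁻¹ := by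
    field_simp
  rw [h5, abs_of_nonneg (mul_nonneg (mul_nonneg (by linarith) (by positivity)) (by positivity))]
  calc (θ / 2 - Real.sin (θ / 2)) * (2 / θ) * (Real.sin (θ / 2))⁻¹
      ≤ ((θ / 2) ^ 3 / 4) * (2 / θ) * (Real.pi / θ) := by gcongr; nlinarith [pow_pos h0 3]
    _ = Real.pi * θ / 16 := by field_simp; norm_num
    _ ≤ 1 := by nlinarith [Real.pi_lt_four, Real.pi_pos]

section

variable {F z : ℝ → ℂ} {δ c K α c₃ : ℝ}

theorem norm_pow_le_of_local_expansion
    (hz : ∀ θ, |θ| ≤ δ → F θ = Complex.exp (Complex.I * (α * θ - c₃ * θ ^ 3 : ℝ))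
      * Complex.exp (z θ))
    (hre : ∀ θ, |θ| ≤ δ → (z θ).re ≤ -(c * θ ^ 4)) (n : ℕ) {θ : ℝ} (hθ : |θ| ≤ δ) :
    ‖F θ‖ ^ n ≤ Real.exp (-(n * c * θ ^ 4)) := by
  rw [hz θ hθ, norm_mul, mul_comm Complex.I, Complex.norm_exp_ofReal_mul_I, one_mul,
    Complex.norm_exp, ← Real.exp_nat_mul]
  apply Real.exp_le_exp.2
  have := mul_le_mul_of_nonneg_left (hre θ hθ) (Nat.cast_nonneg (α := ℝ) n)
  linarith

/-- Mean value inequality on the convex left half-plane, where `|exp| ≤ 1`. -/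
theorem norm_exp_sub_one_le_of_re_nonpos {w : ℂ} (hw : w.re ≤ 0) :
    ‖Complex.exp w - 1‖ ≤ ‖w‖ := by
  have hconv : Convex ℝ {w : ℂ | w.re ≤ 0} := convex_halfSpace_re_le 0
  have := hconv.norm_image_sub_le_of_norm_hasDerivWithin_le (f := Complex.exp)
    (f' := Complex.exp) (C := 1) (x := 0) (y := w)
    (fun v _ => (Complex.hasDerivAt_exp v).hasDerivWithinAt)
    (fun v hv => by rw [Complex.norm_exp]; exact Real.exp_le_one_iff.2 hv) (by simp) hw
  simpa using this

theorem norm_pow_sub_phase_le (hc : 0 < c)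
    (hz : ∀ θ, |θ| ≤ δ → F θ = Complex.exp (Complex.I * (α * θ - c₃ * θ ^ 3 : ℝ))
      * Complex.exp (z θ))
    (hre : ∀ θ, |θ| ≤ δ → (z θ).re ≤ -(c * θ ^ 4))
    (hK : ∀ θ, |θ| ≤ δ → ‖z θ‖ ≤ K * θ ^ 4) (n : ℕ) {θ : ℝ} (hθ : |θ| ≤ δ) (x : ℝ) :
    ‖Complex.exp (-(Complex.I * (x * θ : ℝ))) * F θ ^ n
      - Complex.exp (((n * α - x) * θ - n * c₃ * θ ^ 3 : ℝ) * Complex.I)‖ ≤ n * K * θ ^ 4 := by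
  have e : Complex.exp (-(Complex.I * (x * θ : ℝ))) * F θ ^ n
      - Complex.exp (((n * α - x) * θ - n * c₃ * θ ^ 3 : ℝ) * Complex.I)
      = Complex.exp (((n * α - x) * θ - n * c₃ * θ ^ 3 : ℝ) * Complex.I)
        * (Complex.exp (n * z θ) - 1) := by
    rw [hz θ hθ, mul_pow, ← Complex.exp_nat_mul, ← Complex.exp_nat_mul, ← mul_assoc,
      ← Complex.exp_add, mul_sub, mul_one]
    congr 3
    push_cast
    ring
  rw [e, norm_mul, Complex.norm_exp_ofReal_mul_I, one_mul]
  refine (norm_exp_sub_one_le_of_re_nonpos ?_).trans ?_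
  · have e2 : ((n : ℂ) * z θ).re = n * (z θ).re := by simp [Complex.mul_re]
    rw [e2]
    have : (z θ).re ≤ 0 := (hre θ hθ).trans (by have : 0 ≤ c * θ ^ 4 := by positivity
                                                linarith)
    exact mul_nonpos_of_nonneg_of_nonpos (Nat.cast_nonneg n) this
  · rw [norm_mul, Complex.norm_natCast, mul_assoc]
    exact mul_le_mul_of_nonneg_left (hK θ hθ) (Nat.cast_nonneg n)

/-- The pure phase `e^{ip}`, with `p` odd in `θ`, has odd part `(e^{-ip} - e^{ip}) / 2i = -sin p`,
whence the plus sign. The error is the average of the errors at `θ` and `-θ`. -/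
theorem norm_modulatedOddPart_add_sin_le (hc : 0 < c)
    (hz : ∀ θ, |θ| ≤ δ → F θ = Complex.exp (Complex.I * (α * θ - c₃ * θ ^ 3 : ℝ))
      * Complex.exp (z θ))
    (hre : ∀ θ, |θ| ≤ δ → (z θ).re ≤ -(c * θ ^ 4))
    (hK : ∀ θ, |θ| ≤ δ → ‖z θ‖ ≤ K * θ ^ 4) (n : ℕ) {θ : ℝ} (hθ : |θ| ≤ δ) (x : ℝ) :
    ‖modulatedOddPart F n x θ + (Real.sin ((n * α - x) * θ - n * c₃ * θ ^ 3) : ℝ)‖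
      ≤ n * K * θ ^ 4 := by
  have h1 := norm_pow_sub_phase_le hc hz hre hK n hθ x
  have h2 := norm_pow_sub_phase_le hc hz hre hK n (θ := -θ) (by rwa [abs_neg]) x
  set p := (n * α - x) * θ - n * c₃ * θ ^ 3 with hp
  have hp' : (n * α - x) * -θ - n * c₃ * (-θ) ^ 3 = -p := by rw [hp]; ring
  rw [hp'] at h2
  have e : modulatedOddPart F n x θ + (Real.sin p : ℝ)
      = ((Complex.exp (-(Complex.I * (x * (-θ) : ℝ))) * F (-θ) ^ n
          - Complex.exp ((-p : ℝ) * Complex.I))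
        - (Complex.exp (-(Complex.I * (x * θ : ℝ))) * F θ ^ n
          - Complex.exp (p * Complex.I))) / (2 * Complex.I) := by
    rw [modulatedOddPart, Complex.ofReal_sin, Complex.sin]
    push_cast
    field_simp
    rw [Complex.I_sq]
    ring
  rw [e, norm_div, norm_mul, Complex.norm_I, Complex.norm_two, mul_one, div_le_iff₀ two_pos]
  refine (norm_sub_le _ _).trans ?_
  have e4 : (-θ) ^ 4 = θ ^ 4 := by ring
  rw [e4] at h2
  linarith

theorem integral_inv_pow_five_le {a b : ℝ} (ha : 0 < a) (hab : a ≤ b) :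
    IntervalIntegrable (fun t : ℝ => (t ^ 5)⁻¹) MeasureTheory.volume a b ∧
      ∫ t in a..b, (t ^ 5)⁻¹ ≤ 1 / (4 * a ^ 4) := by
  have hpos : ∀ t ∈ Set.uIcc a b, 0 < t := fun t ht => by
    rw [Set.uIcc_of_le hab] at ht; linarith [ht.1]
  have hi : IntervalIntegrable (fun t : ℝ => (t ^ 5)⁻¹) MeasureTheory.volume a b := by
    apply ContinuousOn.intervalIntegrable
    apply ContinuousOn.inv₀ (by fun_prop)
    intro t ht; exact (pow_pos (hpos t ht) 5).ne'
  refine ⟨hi, ?_⟩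
  rw [intervalIntegral.integral_eq_sub_of_hasDerivAt (f := fun t => -(4 * t ^ 4)⁻¹) _ hi]
  · have : 0 ≤ (4 * b ^ 4)⁻¹ := by positivity
    rw [one_div]; linarith
  · intro t ht
    have := hpos t ht
    refine (((hasDerivAt_pow 4 t).const_mul 4).fun_inv (by positivity)).fun_neg.congr_deriv ?_
    field_simp
    norm_num

/-- The singular integral that represents the partial sums of the Fourier coefficients of `F ^ n`
is bounded uniformly in `n` and in the frequency. -/
theorem exists_forall_norm_integral_modulatedOddPart_le
    (hF1 : ∀ θ ∈ Set.Icc (-Real.pi) Real.pi, ‖F θ‖ ≤ 1) (hδ : 0 < δ) (hδ1 : δ ≤ 1)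
    (hc : 0 < c) (hK0 : 0 ≤ K)
    (hz : ∀ θ, |θ| ≤ δ → F θ = Complex.exp (Complex.I * (α * θ - c₃ * θ ^ 3 : ℝ))
      * Complex.exp (z θ))
    (hre : ∀ θ, |θ| ≤ δ → (z θ).re ≤ -(c * θ ^ 4))
    (hK : ∀ θ, |θ| ≤ δ → ‖z θ‖ ≤ K * θ ^ 4) :
    ∃ C : ℝ, ∀ (n : ℕ) (x : ℝ), n ≠ 0 →
      IntervalIntegrable (fun θ => modulatedOddPart F n x θ / (Real.sin (θ / 2) : ℝ))
        MeasureTheory.volume 0 Real.pi →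
      ‖∫ θ in (0 : ℝ)..Real.pi, modulatedOddPart F n x θ / (Real.sin (θ / 2) : ℝ)‖ ≤ C := by
  have hπ := Real.pi_gt_three
  -- The three summands bound the integral over `[0, A]`, `[A, δ]` and `[δ, π]`.
  refine ⟨(36 + (K * Real.pi + 1)) + Real.pi / c * (1 / (4 * δ ^ 4))
    + Real.pi / δ * Real.pi, fun n x hn hint => ?_⟩
  have hn1 : (1 : ℝ) ≤ n := by exact_mod_cast Nat.one_le_iff_ne_zero.2 hn
  have hn0 : (0 : ℝ) < n := by linarith
  -- `A = δ n^{-1/4}` is the scale at which the damping exponent `n c θ⁴` reaches the fixed size `c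
  -- δ⁴`.
  obtain ⟨A, hA0, hAδ, hA4⟩ : ∃ A : ℝ, 0 < A ∧ A ≤ δ ∧ n * A ^ 4 = δ ^ 4 := by
    have h4 : ((n : ℝ) ^ (1 / 4 : ℝ)) ^ 4 = n := by
      rw [← Real.rpow_natCast, ← Real.rpow_mul hn0.le]; norm_num
    have h5 : (1 : ℝ) ≤ (n : ℝ) ^ (1 / 4 : ℝ) := Real.one_le_rpow hn1 (by norm_num)
    refine ⟨δ / (n : ℝ) ^ (1 / 4 : ℝ), by positivity, div_le_self hδ.le h5, ?_⟩
    rw [div_pow, h4]; field_simp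
  have hδπ : δ ≤ Real.pi := by linarith
  have hdiv : ∀ θ : ℝ, 0 < θ → θ ≤ Real.pi → ∀ r : ℝ, ‖modulatedOddPart F n x θ‖ ≤ r →
      ‖modulatedOddPart F n x θ / (Real.sin (θ / 2) : ℝ)‖ ≤ r * (Real.pi / θ) := by
    intro θ h0 h1 r hr
    obtain ⟨hs, hs'⟩ := one_div_sin_half_le h0 h1
    rw [norm_div, Complex.norm_real, Real.norm_eq_abs, abs_of_pos hs, div_eq_mul_inv]
    have : 0 ≤ r := (norm_nonneg _).trans hr
    gcongr
  have hsub : ∀ a b : ℝ, 0 ≤ a → a ≤ b → b ≤ Real.pi →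
      IntervalIntegrable (fun θ => modulatedOddPart F n x θ / (Real.sin (θ / 2) : ℝ))
        MeasureTheory.volume a b := fun a b ha hab hb => by
    refine hint.mono_set ?_
    rw [Set.uIcc_of_le hab, Set.uIcc_of_le Real.pi_pos.le]
    exact Set.Icc_subset_Icc ha hb
  have i1 := hsub 0 A le_rfl hA0.le (hAδ.trans hδπ)
  have i2 := hsub A δ hA0.le hAδ hδπ
  have i3 := hsub δ Real.pi hδ.le hδπ le_rfl
  have b3 : ‖∫ θ in δ..Real.pi, modulatedOddPart F n x θ / (Real.sin (θ / 2) : ℝ)‖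
      ≤ Real.pi / δ * Real.pi := by
    refine (intervalIntegral.norm_integral_le_of_norm_le_const (C := Real.pi / δ)
      fun θ hθ => ?_).trans ?_
    · rw [Set.uIoc_of_le hδπ] at hθ
      have h0 : 0 < θ := hδ.trans hθ.1
      refine (hdiv θ h0 hθ.2 1 (norm_modulatedOddPart_le ?_ ?_)).trans ?_
      · exact pow_le_one₀ (norm_nonneg _) (hF1 _ ⟨by linarith, hθ.2⟩)
      · exact pow_le_one₀ (norm_nonneg _) (hF1 _ ⟨by linarith [hθ.2], by linarith⟩)
      · rw [one_mul]
        exact div_le_div_of_nonneg_left Real.pi_pos.le hδ hθ.1.le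
    · rw [abs_of_nonneg (by linarith)]
      gcongr
      linarith
  have b2 : ‖∫ θ in A..δ, modulatedOddPart F n x θ / (Real.sin (θ / 2) : ℝ)‖
      ≤ Real.pi / c * (1 / (4 * δ ^ 4)) := by
    obtain ⟨j1, j2⟩ := integral_inv_pow_five_le hA0 hAδ
    refine (intervalIntegral.norm_integral_le_of_norm_le hAδ
      (g := fun θ => Real.pi / (n * c) * (θ ^ 5)⁻¹) ?_ (j1.const_mul _)).trans ?_
    · refine Filter.Eventually.of_forall fun θ hθ => ?_
      have h0 : 0 < θ := hA0.trans hθ.1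
      -- The crude bound `e^{-y} ≤ 1 / y` is enough: the integral of `θ⁻⁵ / n` from `A` is of order
      -- `1 / (n A⁴) = δ⁻⁴`.
      have hle : Real.exp (-(n * c * θ ^ 4)) ≤ (n * c * θ ^ 4)⁻¹ := by
        rw [Real.exp_neg]
        apply inv_anti₀ (by positivity)
        linarith [Real.add_one_le_exp (n * c * θ ^ 4)]
      have habs : |θ| ≤ δ := by rw [abs_of_pos h0]; exact hθ.2
      refine (hdiv θ h0 (hθ.2.trans hδπ) (n * c * θ ^ 4)⁻¹
        (norm_modulatedOddPart_le ?_ ?_)).trans (le_of_eq ?_)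
      · exact (norm_pow_le_of_local_expansion hz hre n habs).trans hle
      · have := norm_pow_le_of_local_expansion hz hre n (θ := -θ) (by rwa [abs_neg])
        have e4 : (-θ) ^ 4 = θ ^ 4 := by ring
        rw [e4] at this
        exact this.trans hle
      · field_simp
    · rw [intervalIntegral.integral_const_mul]
      refine (mul_le_mul_of_nonneg_left j2 (by positivity)).trans (le_of_eq ?_)
      rw [← hA4]; field_simp
  have b1 : ‖∫ θ in (0 : ℝ)..A, modulatedOddPart F n x θ / (Real.sin (θ / 2) : ℝ)‖
      ≤ 36 + (K * Real.pi + 1) := by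
    have js := intervalIntegrable_sin_mul_div
      (r := fun t => (n * α - x) - n * c₃ * t ^ 2) (by fun_prop) 0 A
    have er : ∀ t : ℝ, t * ((n * α - x) - n * c₃ * t ^ 2)
        = (n * α - x) * t - n * c₃ * t ^ 3 := fun t => by ring
    simp only [er] at js
    have hs := abs_integral_sin_linear_sub_cubic_le (n * α - x) (n * c₃) hA0.le
    set S : ℝ → ℝ := fun t => Real.sin ((n * α - x) * t - n * c₃ * t ^ 3) / t with hS
    have jc : IntervalIntegrable (fun t => ((2 * S t : ℝ) : ℂ)) MeasureTheory.volume 0 A :=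
      ⟨(js.const_mul 2).1.ofReal, (js.const_mul 2).2.ofReal⟩
    -- Two replacements: the odd part by `-sin p`, costing `n K θ⁴ · π / θ`, and `1 / sin(θ/2)` by
    -- `2 / θ`, costing at most `1`. The remaining term `-2 S` contributes `2 · 18 = 36`.
    have hd := intervalIntegral.norm_integral_le_of_norm_le_const (a := 0) (b := A)
      (C := n * K * A ^ 3 * Real.pi + 1)
      (f := fun θ => modulatedOddPart F n x θ / (Real.sin (θ / 2) : ℝ) + ((2 * S θ : ℝ) : ℂ))
      (fun θ hθ => by
        rw [Set.uIoc_of_le hA0.le] at hθ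
        have h0 := hθ.1
        have habs : |θ| ≤ δ := by rw [abs_of_pos h0]; exact hθ.2.trans hAδ
        have hθ1 : θ ≤ 1 := hθ.2.trans (hAδ.trans hδ1)
        obtain ⟨hs, hs'⟩ := one_div_sin_half_le h0 (by linarith)
        have g1 := norm_modulatedOddPart_add_sin_le hc hz hre hK n habs x
        have g2 := abs_inv_sin_half_sub_le h0 hθ1
        set σ := Real.sin ((n * α - x) * θ - n * c₃ * θ ^ 3) with hσ
        have e : modulatedOddPart F n x θ / (Real.sin (θ / 2) : ℝ) + ((2 * S θ : ℝ) : ℂ)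
            = (modulatedOddPart F n x θ + σ) * ((Real.sin (θ / 2))⁻¹ : ℝ)
              - ((σ * ((Real.sin (θ / 2))⁻¹ - 2 / θ) : ℝ) : ℂ) := by
          simp only [hS, ← hσ]
          push_cast
          ring
        rw [e]
        refine (norm_sub_le _ _).trans (add_le_add ?_ ?_)
        · rw [norm_mul, Complex.norm_real, Real.norm_eq_abs, abs_of_pos (inv_pos.2 hs)]
          calc _ ≤ (n * K * θ ^ 4) * (Real.pi / θ) := by gcongr
            _ = n * K * θ ^ 3 * Real.pi := by field_simp
            _ ≤ n * K * A ^ 3 * Real.pi := by gcongr; exact hθ.2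
        · rw [Complex.norm_real, norm_mul, Real.norm_eq_abs, Real.norm_eq_abs]
          exact mul_le_one₀ (Real.abs_sin_le_one _) (abs_nonneg _) g2)
    rw [intervalIntegral.integral_add i1 jc, intervalIntegral.integral_ofReal,
      intervalIntegral.integral_const_mul, sub_zero, abs_of_pos hA0] at hd
    have hd2 : (n * K * A ^ 3 * Real.pi + 1) * A ≤ K * Real.pi + 1 := by
      have e : (n * K * A ^ 3 * Real.pi + 1) * A = (n * A ^ 4) * (K * Real.pi) + A := by ring
      rw [e, hA4]
      have : δ ^ 4 ≤ 1 := pow_le_one₀ hδ.le hδ1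
      have hKπ : 0 ≤ K * Real.pi := by positivity
      nlinarith
    have hs2 : ‖((2 * ∫ t in (0 : ℝ)..A, S t : ℝ) : ℂ)‖ ≤ 36 := by
      rw [Complex.norm_real, norm_mul, Real.norm_eq_abs, Real.norm_eq_abs, abs_two]
      linarith
    have := norm_sub_le ((∫ θ in (0 : ℝ)..A, modulatedOddPart F n x θ / (Real.sin (θ / 2) : ℝ))
      + ((2 * ∫ t in (0 : ℝ)..A, S t : ℝ) : ℂ)) ((2 * ∫ t in (0 : ℝ)..A, S t : ℝ) : ℂ)
    rw [add_sub_cancel_right] at this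
    linarith
  rw [← intervalIntegral.integral_add_adjacent_intervals (i1.trans i2) i3,
    ← intervalIntegral.integral_add_adjacent_intervals i1 i2]
  exact (norm_add_le _ _).trans (add_le_add ((norm_add_le _ _).trans (add_le_add b1 b2)) b3)

end

/-! ### Dirichlet kernel and partial sums of Fourier coefficients -/

theorem sin_nat_add_half_eq (k : ℕ) (θ : ℝ) :
    Real.sin ((k + 1 / 2) * θ)
      = (1 + ∑ i ∈ Finset.range k, 2 * Real.cos ((i + 1) * θ)) * Real.sin (θ / 2) := by
  induction k with
  | zero => simp [div_eq_inv_mul]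
  | succ k ih =>
    rw [Finset.sum_range_succ, ← add_assoc, add_mul _ _ (Real.sin (θ / 2)), ← ih]
    have h1 : ((k + 1 : ℕ) + 1 / 2) * θ = (k + 1) * θ + θ / 2 := by push_cast; ring
    have h2 : (k + 1 / 2) * θ = (k + 1) * θ - θ / 2 := by ring
    rw [h1, h2, Real.sin_add, Real.sin_sub]
    ring

theorem dirichletKernel_integral_nat (k : ℕ) :
    IntervalIntegrable (fun θ => Real.sin ((k + 1 / 2) * θ) / Real.sin (θ / 2))
        MeasureTheory.volume 0 Real.pi ∧
      ∫ θ in (0 : ℝ)..Real.pi, Real.sin ((k + 1 / 2) * θ) / Real.sin (θ / 2) = Real.pi := by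
  have he : Set.EqOn (fun θ => 1 + ∑ i ∈ Finset.range k, 2 * Real.cos ((i + 1) * θ))
      (fun θ => Real.sin ((k + 1 / 2) * θ) / Real.sin (θ / 2)) (Set.uIoc 0 Real.pi) := by
    intro θ hθ
    rw [Set.uIoc_of_le Real.pi_pos.le] at hθ
    simp only
    rw [sin_nat_add_half_eq, mul_div_cancel_right₀ _ (one_div_sin_half_le hθ.1 hθ.2).1.ne']
  have hc : ∀ i ∈ Finset.range k, IntervalIntegrable
      (fun θ : ℝ => 2 * Real.cos ((i + 1) * θ)) MeasureTheory.volume 0 Real.pi := fun i _ =>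
    Continuous.intervalIntegrable (by fun_prop) _ _
  constructor
  · exact (Continuous.intervalIntegrable (by fun_prop) 0 Real.pi).congr he
  · rw [← intervalIntegral.integral_congr_ae (Filter.Eventually.of_forall he), intervalIntegral.integral_add
      (by simp) (Continuous.intervalIntegrable (by fun_prop) _ _),
      intervalIntegral.integral_finsetSum hc, Finset.sum_eq_zero]
    · simp
    · intro i _
      have hi : (i + 1 : ℝ) ≠ 0 := by positivity
      rw [intervalIntegral.integral_const_mul, intervalIntegral.integral_comp_mul_left _ hi,
        integral_cos]
      have : Real.sin ((i + 1) * Real.pi) = 0 := by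
        exact_mod_cast Real.sin_nat_mul_pi (i + 1)
      simp [this]

/-- The conjugate-type Dirichlet integral that recovers the sign of a half-integer. -/
theorem dirichletKernel_integral_int (k : ℤ) :
    IntervalIntegrable (fun θ => Real.sin ((k - 1 / 2) * θ) / Real.sin (θ / 2))
        MeasureTheory.volume 0 Real.pi ∧
      ∫ θ in (0 : ℝ)..Real.pi, Real.sin ((k - 1 / 2) * θ) / Real.sin (θ / 2)
        = if 0 < k then Real.pi else -Real.pi := by
  by_cases hk : 0 < k
  -- The shift by `1/2` pairs `k = m + 1` with `k = -m`: the frequencies are `m + 1/2` and its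
  -- opposite, so `k = 0` falls on the negative side.
  · obtain ⟨m, rfl⟩ : ∃ m : ℕ, k = m + 1 := ⟨(k - 1).toNat, by omega⟩
    have e : (((m + 1 : ℤ) : ℝ) - 1 / 2) = m + 1 / 2 := by push_cast; ring
    rw [e, if_pos hk]
    exact dirichletKernel_integral_nat m
  · obtain ⟨m, rfl⟩ : ∃ m : ℕ, k = -m := ⟨(-k).toNat, by omega⟩
    have e : ∀ θ : ℝ, Real.sin ((((-m : ℤ) : ℝ) - 1 / 2) * θ) / Real.sin (θ / 2)
        = -(Real.sin ((m + 1 / 2) * θ) / Real.sin (θ / 2)) := fun θ => by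
      rw [← neg_div, ← Real.sin_neg]; congr 2; push_cast; ring
    simp only [e, if_neg hk, intervalIntegral.integral_neg]
    obtain ⟨h1, h2⟩ := dirichletKernel_integral_nat m
    exact ⟨h1.neg, by rw [h2]⟩

/-- Partial sums of the coefficients of a trigonometric polynomial `∑ b_i e^{i e_i θ} = F(θ)^n`
as a singular integral. -/
theorem sum_ite_eq_integral_modulatedOddPart {ι : Type*} (s : Finset ι) (b : ι → ℂ) (e : ι → ℤ)
    (F : ℝ → ℂ) (n : ℕ)
    (hF : ∀ θ : ℝ, ∑ i ∈ s, b i * Complex.exp (Complex.I * (e i : ℂ) * θ) = F θ ^ n) (m : ℤ) :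
    IntervalIntegrable (fun θ => modulatedOddPart F n (m - 1 / 2) θ / (Real.sin (θ / 2) : ℝ))
        MeasureTheory.volume 0 Real.pi ∧
      ∑ i ∈ s, b i * (if 0 < m - e i then 1 else 0)
        = F 0 ^ n / 2 + (∫ θ in (0 : ℝ)..Real.pi,
          modulatedOddPart F n (m - 1 / 2) θ / (Real.sin (θ / 2) : ℝ)) / (2 * Real.pi) := by
  -- Term by term, the odd part of `e^{-iyθ}` with `y = m - e i - 1/2` is `sin (y θ)`.
  have hT : ∀ θ : ℝ, modulatedOddPart F n (m - 1 / 2) θ / (Real.sin (θ / 2) : ℝ)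
      = ∑ i ∈ s, b i * ((Real.sin (((m - e i : ℤ) - 1 / 2) * θ) / Real.sin (θ / 2) : ℝ) : ℂ) := by
    intro θ
    rw [modulatedOddPart, ← hF, ← hF, Finset.mul_sum, Finset.mul_sum, ← Finset.sum_sub_distrib,
      Finset.sum_div, Finset.sum_div]
    refine Finset.sum_congr rfl fun i _ => ?_
    have h1 : ∀ θ : ℝ, Complex.exp (-(Complex.I * (((m : ℝ) - 1 / 2) * θ : ℝ)))
        * (b i * Complex.exp (Complex.I * (e i : ℂ) * θ))
        = b i * Complex.exp (-(((m - e i : ℤ) - 1 / 2) * θ : ℝ) * Complex.I) := fun θ => by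
      rw [mul_left_comm, ← Complex.exp_add]
      congr 2
      push_cast
      ring
    rw [h1, h1, Complex.ofReal_div, Complex.ofReal_sin (_ * θ), Complex.sin]
    have h2 : -(((m - e i : ℤ) - 1 / 2) * -θ : ℝ) = (((m - e i : ℤ) - 1 / 2) * θ : ℝ) := by ring
    have h3 : (-((((m - e i : ℤ) - 1 / 2) * -θ : ℝ) : ℂ))
      = (((m - e i : ℤ) - 1 / 2) * θ : ℝ) := by rw [← h2]; push_cast; ring
    rw [h3]
    generalize (((m - e i : ℤ) - 1 / 2) * θ : ℝ) = y
    generalize (Real.sin (θ / 2) : ℝ) = w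
    rw [div_right_comm, mul_div_assoc, mul_comm (2 : ℂ), ← div_div, Complex.div_I]
    ring
  have hi : ∀ i ∈ s, IntervalIntegrable (fun θ : ℝ => b i *
      ((Real.sin (((m - e i : ℤ) - 1 / 2) * θ) / Real.sin (θ / 2) : ℝ) : ℂ))
      MeasureTheory.volume 0 Real.pi := fun i _ => by
    have h := (dirichletKernel_integral_int (m - e i)).1
    exact IntervalIntegrable.const_mul ⟨h.1.ofReal, h.2.ofReal⟩ _
  simp only [hT]
  constructor
  · simpa only [Finset.sum_fn] using IntervalIntegrable.sum s hi
  · have h0 : F 0 ^ n = ∑ i ∈ s, b i := by rw [← hF]; simp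
    rw [intervalIntegral.integral_finsetSum hi, h0, Finset.sum_div, Finset.sum_div,
      ← Finset.sum_add_distrib]
    refine Finset.sum_congr rfl fun i _ => ?_
    rw [intervalIntegral.integral_const_mul, intervalIntegral.integral_ofReal,
      (dirichletKernel_integral_int (m - e i)).2]
    have hπ : (Real.pi : ℂ) ≠ 0 := Complex.ofReal_ne_zero.2 Real.pi_ne_zero
    split_ifs
    · field_simp; norm_num
    · push_cast; field_simp; norm_num

/-! ### Reduction from bounded variation to the step function -/

namespace LaurentBV

theorem laurentOp_eq_sum {a : ℤ → ℂ} (h : (Function.support a).Finite) (u : ℤ → ℂ) (j : ℤ) :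
    laurentOp a u j = ∑ ℓ ∈ h.toFinset, a ℓ * u (j - ℓ) := by
  refine tsum_eq_sum fun ℓ hℓ => ?_
  have : a ℓ = 0 := by simpa using hℓ
  rw [this, zero_mul]

/-- The expansion is left uncollected, so several indices may share a shift `e i`; this avoids
convolution powers and keeps the coefficients independent of `u`. -/
theorem exists_iterate_laurentOp_eq_sum {a : ℤ → ℂ} (h : (Function.support a).Finite) (n : ℕ) :
    ∃ (ι : Type) (s : Finset ι) (b : ι → ℂ) (e : ι → ℤ), ∀ (u : ℤ → ℂ) (j : ℤ),
      (laurentOp a)^[n] u j = ∑ i ∈ s, b i * u (j - e i) := by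
  induction n with
  | zero => exact ⟨Unit, Finset.univ, fun _ => 1, fun _ => 0, by simp⟩
  | succ n ih =>
    obtain ⟨ι, s, b, e, hb⟩ := ih
    refine ⟨ι × ℤ, s ×ˢ h.toFinset, fun p => b p.1 * a p.2, fun p => e p.1 + p.2,
      fun u j => ?_⟩
    rw [Function.iterate_succ_apply, hb, Finset.sum_product]
    refine Finset.sum_congr rfl fun i _ => ?_
    rw [laurentOp_eq_sum h, Finset.mul_sum]
    refine Finset.sum_congr rfl fun ℓ _ => ?_
    rw [mul_assoc, sub_sub]

/-- Exponentials are eigenvectors. Evaluated at `j = 0`, this identifies the trigonometric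
polynomial of the coefficients of `L_a^n` as `F_a^n`. -/
theorem iterate_laurentOp_exp (a : ℤ → ℂ) (n : ℕ) (θ : ℂ) (j : ℤ) :
    (laurentOp a)^[n] (fun k => Complex.exp (-(Complex.I * (k : ℂ) * θ))) j
      = fourierSymbol a θ ^ n * Complex.exp (-(Complex.I * (j : ℂ) * θ)) := by
  induction n generalizing j with
  | zero => simp
  | succ n ih =>
    rw [Function.iterate_succ_apply', laurentOp, pow_succ', mul_assoc]
    generalize hw : fourierSymbol a θ ^ n = w at ih ⊢
    rw [fourierSymbol, ← tsum_mul_right]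
    refine tsum_congr fun ℓ => ?_
    have e : Complex.exp (-(Complex.I * ((j - ℓ : ℤ) : ℂ) * θ))
        = Complex.exp (Complex.I * ℓ * θ) * Complex.exp (-(Complex.I * j * θ)) := by
      rw [← Complex.exp_add]
      congr 1
      push_cast
      ring
    rw [ih, e]
    ring

/-- A sequence of bounded variation vanishing at `-∞` is the sum of its jumps. -/
theorem hasSum_jumps {u : ℤ → ℂ} (hu : Summable fun k => u (k + 1) - u k)
    (h0 : Filter.Tendsto u Filter.atBot (𝓝 0)) (m : ℤ) :
    HasSum (fun k => (u (k + 1) - u k) * (if 0 < m - k then 1 else 0)) (u m) := by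
  -- The map `i ↦ m - 1 - i` enumerates the integers `k < m`, where the indicator equals `1`, so the
  -- partial sums telescope to `u m - u (m - N)`.
  have hinj : Function.Injective fun i : ℕ => m - 1 - (i : ℤ) := fun i j hij => by
    simp only at hij; omega
  rw [← hinj.hasSum_iff]
  · have hs : Summable ((fun k => (u (k + 1) - u k) * (if 0 < m - k then 1 else 0))
        ∘ fun i : ℕ => m - 1 - (i : ℤ)) := by
      refine (hu.comp_injective hinj).congr fun i => ?_
      simp only [Function.comp]
      rw [if_pos (by omega), mul_one]
    refine (hs.hasSum_iff_tendsto_nat).2 ?_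
    have hpart : ∀ N : ℕ, ∑ i ∈ Finset.range N,
        ((fun k => (u (k + 1) - u k) * (if 0 < m - k then 1 else 0))
        ∘ fun i : ℕ => m - 1 - (i : ℤ)) i = u m - u (m - N) := fun N => by
      have := Finset.sum_range_sub' (fun i : ℕ => u (m - i)) N
      simp only [Nat.cast_zero, sub_zero] at this
      rw [← this]
      refine Finset.sum_congr rfl fun i _ => ?_
      simp only [Function.comp]
      rw [if_pos (by omega), mul_one]
      congr 2
      · ring
      · push_cast; ring
    simp only [hpart]
    have ht : Filter.Tendsto (fun N : ℕ => m - (N : ℤ)) Filter.atTop Filter.atBot :=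
      Filter.tendsto_atBot.2 fun c => by
        filter_upwards [Filter.eventually_ge_atTop (m - c).toNat] with N hN
        omega
    simpa using (h0.comp ht).const_sub (u m)
  · intro k hk
    rw [if_neg, mul_zero]
    intro hpos
    exact hk ⟨(m - 1 - k).toNat, by simp only; omega⟩

/-- The operators `L_a^n` are bounded on the step function uniformly in `n`. -/
theorem exists_forall_norm_iterate_laurentOp_step_le {a : ℤ → ℂ} (ha : DispersiveAssumption a) :
    ∃ C : ℝ, ∀ (n : ℕ) (m : ℤ), ‖(laurentOp a)^[n] (fun k => if 0 < k then 1 else 0) m‖ ≤ C := by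
  obtain ⟨α, c₃, c₄, -, hc₄, φ, hφ, hexp⟩ := ha.expansion
  have hF0 : fourierSymbol a 0 = 1 := by simp [fourierSymbol, ha.sum_eq_one]
  have hM : ∀ᶠ θ : ℂ in 𝓝 0, ‖φ θ‖ < ‖φ 0‖ + 1 :=
    hφ.continuousAt.norm.eventually_lt_const (lt_add_one _)
  obtain ⟨ε, hε, hball⟩ := Metric.eventually_nhds_iff.1 (hexp.and hM)
  set M := ‖φ 0‖ + 1 with hMdef
  have hM0 : 0 < M := by positivity
  -- The condition `δ * M ≤ c₄ / 2` lets the quintic remainder consume at most half of the quartic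
  -- damping, leaving `c = c₄ / 2` and `K = c₄ + c₄ / 2`.
  obtain ⟨δ, hδ, hδ1, hδε, hδM⟩ : ∃ δ : ℝ, 0 < δ ∧ δ ≤ 1 ∧ δ < ε ∧ δ * M ≤ c₄ / 2 := by
    refine ⟨min 1 (min (ε / 2) (c₄ / 2 / M)), by positivity, min_le_left _ _, ?_, ?_⟩
    · exact ((min_le_right _ _).trans (min_le_left _ _)).trans_lt (by linarith)
    · rw [← le_div_iff₀ hM0]
      exact (min_le_right _ _).trans (min_le_right _ _)
  set F : ℝ → ℂ := fun θ => fourierSymbol a (θ : ℂ) with hF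
  set z : ℝ → ℂ := fun θ => -(c₄ : ℂ) * (θ : ℂ) ^ 4 + (θ : ℂ) ^ 5 * φ θ with hz
  have hmem : ∀ θ : ℝ, |θ| ≤ δ → dist (θ : ℂ) 0 < ε := fun θ hθ => by
    rw [dist_zero_right, Complex.norm_real, Real.norm_eq_abs]; linarith
  have hrem : ∀ θ : ℝ, |θ| ≤ δ → ‖(θ : ℂ) ^ 5 * φ θ‖ ≤ c₄ / 2 * θ ^ 4 := fun θ hθ => by
    have h1 := (hball (hmem θ hθ)).2.le
    rw [norm_mul, norm_pow, Complex.norm_real, Real.norm_eq_abs]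
    calc |θ| ^ 5 * ‖φ θ‖ = |θ| ^ 4 * (|θ| * ‖φ θ‖) := by ring
      _ ≤ |θ| ^ 4 * (δ * M) := by gcongr
      _ ≤ |θ| ^ 4 * (c₄ / 2) := by gcongr
      _ = c₄ / 2 * θ ^ 4 := by rw [Even.pow_abs (by decide)]; ring
  have hmain : ∀ θ : ℝ, -(c₄ : ℂ) * (θ : ℂ) ^ 4 = ((-(c₄ * θ ^ 4) : ℝ) : ℂ) := fun θ => by
    push_cast; ring
  obtain ⟨C, hC⟩ := exists_forall_norm_integral_modulatedOddPart_le (F := F) (z := z) (δ := δ)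
    (c := c₄ / 2) (K := c₄ + c₄ / 2) (α := α) (c₃ := c₃)
    (fun θ hθ => by
      rcases eq_or_ne θ 0 with rfl | h
      · simp [hF, hF0]
      · exact (ha.dissipation θ ⟨hθ, h⟩).le)
    hδ hδ1 (by positivity) (by positivity)
    (fun θ hθ => by
      simp only [hF, hz]
      rw [(hball (hmem θ hθ)).1, ← Complex.exp_add]
      congr 1
      push_cast
      ring)
    (fun θ hθ => by
      simp only [hz]
      rw [Complex.add_re, hmain, Complex.ofReal_re]
      have := (Complex.re_le_norm _).trans (hrem θ hθ)
      linarith)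
    (fun θ hθ => by
      simp only [hz]
      refine (norm_add_le _ _).trans ?_
      rw [hmain, Complex.norm_real, norm_neg, Real.norm_eq_abs,
        abs_of_nonneg (by positivity), add_mul]
      linarith [hrem θ hθ])
  refine ⟨max 1 (1 / 2 + C), fun n m => ?_⟩
  -- The cutoff `n^{-1/4}` requires `n ≠ 0`; for `n = 0` the step itself is bounded by `1`.
  rcases eq_or_ne n 0 with rfl | hn
  · refine le_max_of_le_left ?_
    simp only [Function.iterate_zero, id]
    split_ifs <;> simp
  refine le_max_of_le_right ?_
  obtain ⟨ι, s, b, e, hb⟩ := exists_iterate_laurentOp_eq_sum ha.finite_support n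
  have hsym : ∀ θ : ℝ, ∑ i ∈ s, b i * Complex.exp (Complex.I * (e i : ℂ) * θ) = F θ ^ n := by
    intro θ
    have h1 := hb (fun k => Complex.exp (-(Complex.I * (k : ℂ) * θ))) 0
    rw [iterate_laurentOp_exp] at h1
    simpa using h1.symm
  obtain ⟨hint, hsum⟩ := sum_ite_eq_integral_modulatedOddPart s b e F n hsym m
  have hbound := hC n (m - 1 / 2) hn hint
  rw [hb, hsum]
  refine (norm_add_le _ _).trans (add_le_add ?_ ?_)
  · simp [hF, hF0]
  · rw [norm_div]
    refine (div_le_self (norm_nonneg _) ?_).trans hbound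
    rw [norm_mul, Complex.norm_two, Complex.norm_real, Real.norm_eq_abs,
      abs_of_pos Real.pi_pos]
    linarith [Real.pi_gt_three]

theorem enorm_iterate_laurentOp_le {a : ℤ → ℂ} (h : (Function.support a).Finite) {n : ℕ} {C : ℝ≥0}
    (hC : ∀ m : ℤ, ‖(laurentOp a)^[n] (fun k => if 0 < k then 1 else 0) m‖ ≤ C)
    {u : ℤ → ℂ} (hu : BV u) (h0 : Filter.Tendsto u Filter.atBot (𝓝 0)) (j : ℤ) :
    ‖(laurentOp a)^[n] u j‖ₑ ≤ C * totalVariation u := by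
  obtain ⟨ι, s, b, e, hb⟩ := exists_iterate_laurentOp_eq_sum h n
  have hsum : Summable fun k => u (k + 1) - u k := by
    refine Summable.of_nnnorm (ENNReal.tsum_coe_ne_top_iff_summable.1 ?_)
    exact hu.ne
  -- For fixed `n` only finitely many translates are combined, so the sum over jumps can be
  -- exchanged with the sum over `i`; the weight of the jump at `k` is the evolved step at `j - k`.
  have hs : HasSum (fun k => (u (k + 1) - u k)
      * (laurentOp a)^[n] (fun k => if 0 < k then 1 else 0) (j - k)) ((laurentOp a)^[n] u j) := by
    rw [hb]
    refine (hasSum_sum fun i _ => (hasSum_jumps hsum h0 (j - e i)).mul_left (b i)).congr_fun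
      fun k => ?_
    rw [hb, Finset.mul_sum]
    refine Finset.sum_congr rfl fun i _ => ?_
    rw [sub_right_comm]
    ring
  rw [← hs.tsum_eq, totalVariation, ← ENNReal.tsum_mul_left]
  refine enorm_tsum_le_tsum_enorm.trans (ENNReal.tsum_le_tsum fun k => ?_)
  rw [enorm_mul, mul_comm]
  gcongr
  rw [enorm_eq_nnnorm]
  exact_mod_cast hC (j - k)

end LaurentBV

theorem corollary3 (a : ℤ → ℂ) (ha : LaurentBV.DispersiveAssumption a) :
    ∃ C : ℝ≥0, 0 < C ∧
      ∀ u : ℤ → ℂ, LaurentBV.BV u → Filter.Tendsto u Filter.atBot (𝓝 0) →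
        (⨆ n : ℕ, LaurentBV.supNorm ((LaurentBV.laurentOp a)^[n] u))
          ≤ (C : ℝ≥0∞) * LaurentBV.totalVariation u := by
  obtain ⟨C, hC⟩ := LaurentBV.exists_forall_norm_iterate_laurentOp_step_le ha
  refine ⟨C.toNNReal + 1, by positivity, fun u hu h0 => iSup_le fun n => iSup_le fun j => ?_⟩
  refine LaurentBV.enorm_iterate_laurentOp_le ha.finite_support (fun m => (hC n m).trans ?_)
    hu h0 j
  push_cast
  linarith [Real.le_coe_toNNReal C]
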